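/- \textbf{Conventions.} All locally convex spaces are real and Hausdorff; no completeness is assumed. Let $a<b$ be real numbers. A map $f\colon U\to F$ from an open subset $U$ of a locally convex space $E$ to a locally convex space $F$ is called $C^0$ if it is continuous. For $n\ge 1$ it is called $C^n$ if it is continuous, all directional derivatives $df(x,y)=\lim_{h\to 0}\frac{1}{h}\bigl(f(x+hy)-f(x)\bigr)$ ($x\in U$, $y\in E$) exist in $F$, and $df\colon U\times E\to F$ is $C^{n-1}$. It is called $C^\infty$ if it is $C^n$ for all $n\in\mathbb{N}$. A function $\gamma\colon[a,b]\to E$ is called Lusin measurable if for every compact $K\subseteq[a,b]$ there are compact sets $K_n\subseteq K$ ($n\in\mathbb{N}$) such that each $\gamma|_{K_n}$ is continuous and $K\setminus\bigcup_n K_n$ has Lebesgue measure $0$. For $p\in[1,\infty]$ let $\mathcal{L}^p([a,b],E)$ be the vector space of all Lusin measurable $\gamma\colon[a,b]\to E$ such that $q\circ\gamma$ belongs to the scalar space $\mathcal{L}^p([a,b])$ (with respect to Lebesgue measure) for every continuous seminorm $q$ on $E$. Let $L^p([a,b],E)$ be its quotient by the subspace of functions vanishing almost everywhere, with the locally convex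 topology defined by the seminorms $\|[\gamma]\|_{L^p,q}=\|q\circ\gamma\|_{\mathcal{L}^p}$, where $q$ ranges over the continuous seminorms on $E$. The space $C([a,b],E)$ of continuous maps carries the topology of uniform convergence, and for an open set $V\subseteq E$ we write $C([a,b],V)$ for its open subset of maps with values in $V$. \textbf{Proposition.} Let $E_1,E_2,F$ be locally convex spaces, let $V\subseteq E_1$ be open, let $k\in\mathbb{N}\cup\{0,\infty\}$ (with $\infty+1=\infty$), and let $f\colon V\times E_2\to F$ be a $C^{k+1}$-map which is linear in its second argument. Then for every $p\in[1,\infty]$ the map $$\Theta_f\colon C([a,b],V)\times L^p([a,b],E_2)\to L^p([a,b],F),\qquad (\eta,[\gamma])\mapsto[f\circ(\eta,\gamma)],$$ is well defined and $C^k$. -/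

import Mathlib

open Set Filter Topology MeasureTheory
open scoped ENNReal

noncomputable section

universe u v

/-! ### Differentiability in the sense of Bastiani (Keller's `C^k_c`-calculus) -/

/-- `BastianiCn n U f`: the map `f`, considered on the open set `U`, is `C^n` (`n` finite).
It is continuous on `U` and, for `n ≥ 1`, all directional derivatives
`df (x, y) = lim_{h → 0} h⁻¹ (f (x + h y) - f x)` with `x ∈ U` exist and `df` is `C^(n-1)` on
`U × E`.  Only the values of `f` on `U` matter, as `U` is open. -/
def BastianiCn {F : Type v} [AddCommGroup F] [Module ℝ F] [TopologicalSpace F] :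
    ℕ → ∀ {E : Type u} [AddCommGroup E] [Module ℝ E] [TopologicalSpace E],
      Set E → (E → F) → Prop
  | 0, _, _, _, _, U, f => ContinuousOn f U
  | n + 1, E, _, _, _, U, f => ContinuousOn f U ∧ ∃ df : E × E → F,
      (∀ x ∈ U, ∀ y : E,
        Tendsto (fun h : ℝ => h⁻¹ • (f (x + h • y) - f x)) (𝓝[≠] 0) (𝓝 (df (x, y)))) ∧
      BastianiCn n (U ×ˢ (univ : Set E)) df

/-- `f` is `C^k` on the open set `U`, for `k ∈ ℕ ∪ {∞}`. For finite `k` this is `BastianiCn k`, see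
`bastianiC_natCast`; for `k = ∞` it says that `f` is `C^n` for every `n`. -/
def BastianiC {E : Type u} {F : Type v} [AddCommGroup E] [Module ℝ E] [TopologicalSpace E]
    [AddCommGroup F] [Module ℝ F] [TopologicalSpace F] (k : ℕ∞) (U : Set E) (f : E → F) : Prop :=
  ∀ n : ℕ, (n : ℕ∞) ≤ k → BastianiCn n U f

theorem BastianiCn.of_succ {F : Type v} [AddCommGroup F] [Module ℝ F] [TopologicalSpace F]
    (n : ℕ) : ∀ {E : Type u} [AddCommGroup E] [Module ℝ E] [TopologicalSpace E]
      {U : Set E} {f : E → F}, BastianiCn (n + 1) U f → BastianiCn n U f := by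
  induction n with
  | zero => intro E _ _ _ U f h; exact h.1
  | succ n ih =>
    intro E _ _ _ U f h
    obtain ⟨hc, df, hd, hdf⟩ := h
    exact ⟨hc, df, hd, ih hdf⟩

theorem bastianiC_natCast {E : Type u} {F : Type v} [AddCommGroup E] [Module ℝ E]
    [TopologicalSpace E] [AddCommGroup F] [Module ℝ F] [TopologicalSpace F] (n : ℕ) (U : Set E)
    (f : E → F) : BastianiC (n : ℕ∞) U f ↔ BastianiCn n U f := by
  refine ⟨fun h => h n le_rfl, fun h m hm => ?_⟩
  exact Nat.decreasingInduction (motive := fun m _ => BastianiCn m U f)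
    (fun _ _ h => h.of_succ) h (Nat.cast_le.mp hm)

/-! ### Lusin measurable functions -/

/-- Lusin `μ`-measurability: for every compact `K` there are compact sets `K_n ⊆ K` such that each
restriction of `γ` to `K_n` is continuous and `μ (K \ ⋃ K_n) = 0`. -/
def LusinMeasurable {X Y : Type*} [TopologicalSpace X] [MeasurableSpace X] [TopologicalSpace Y]
    (μ : Measure X) (γ : X → Y) : Prop :=
  ∀ K : Set X, IsCompact K → ∃ Kn : ℕ → Set X,
    (∀ n, IsCompact (Kn n) ∧ Kn n ⊆ K ∧ ContinuousOn γ (Kn n)) ∧ μ (K \ ⋃ n, Kn n) = 0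

theorem LusinMeasurable.of_continuous {X Y : Type*} [TopologicalSpace X] [MeasurableSpace X]
    [TopologicalSpace Y] {μ : Measure X} {γ : X → Y} (h : Continuous γ) : LusinMeasurable μ γ :=
  fun K hK => ⟨fun _ => K, fun _ => ⟨hK, subset_rfl, h.continuousOn⟩, by simp [iUnion_const]⟩

theorem LusinMeasurable.comp {X Y Z : Type*} [TopologicalSpace X] [MeasurableSpace X]
    [TopologicalSpace Y] [TopologicalSpace Z] {μ : Measure X} {γ : X → Y} {g : Y → Z}
    (hg : Continuous g) (h : LusinMeasurable μ γ) : LusinMeasurable μ (fun x => g (γ x)) := by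
  intro K hK
  obtain ⟨Kn, h1, h2⟩ := h K hK
  exact ⟨Kn, fun n => ⟨(h1 n).1, (h1 n).2.1, hg.comp_continuousOn (h1 n).2.2⟩, h2⟩

theorem LusinMeasurable.prodMk {X Y Z : Type*} [TopologicalSpace X] [T2Space X] [MeasurableSpace X]
    [TopologicalSpace Y] [TopologicalSpace Z] {μ : Measure X} {γ : X → Y} {η : X → Z}
    (h : LusinMeasurable μ γ) (h' : LusinMeasurable μ η) :
    LusinMeasurable μ (fun x => (γ x, η x)) := by
  intro K hK
  obtain ⟨A, h1, h2⟩ := h K hK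
  obtain ⟨B, h3, h4⟩ := h' K hK
  refine ⟨fun n => A n.unpair.1 ∩ B n.unpair.2, fun n =>
    ⟨(h1 _).1.inter (h3 _).1, inter_subset_left.trans (h1 _).2.1,
      ((h1 _).2.2.mono inter_subset_left).prodMk ((h3 _).2.2.mono inter_subset_right)⟩, ?_⟩
  refine measure_mono_null ?_ (measure_union_null h2 h4)
  rintro x ⟨hxK, hx⟩
  by_contra hcon
  simp only [mem_union, Set.mem_sdiff, hxK, true_and, not_or, not_not, mem_iUnion] at hcon
  obtain ⟨⟨i, hi⟩, ⟨j, hj⟩⟩ := hcon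
  exact hx (mem_iUnion.2 ⟨Nat.pair i j, by simpa using ⟨hi, hj⟩⟩)

theorem LusinMeasurable.aestronglyMeasurable {X : Type*} [TopologicalSpace X] [T2Space X]
    [CompactSpace X] [MeasurableSpace X] [BorelSpace X] {μ : Measure X} {γ : X → ℝ}
    (h : LusinMeasurable μ γ) : AEStronglyMeasurable γ μ := by
  obtain ⟨A, h1, h2⟩ := h univ isCompact_univ
  have h3 : AEStronglyMeasurable γ (μ.restrict (⋃ n, A n)) :=
    aestronglyMeasurable_iUnion_iff.2 fun n =>
      ((h1 n).2.2.aemeasurable (h1 n).1.measurableSet).aestronglyMeasurable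
  have h4 : μ.restrict (⋃ n, A n) = μ := by
    apply Measure.restrict_eq_self_of_ae_mem
    rw [ae_iff]
    convert h2 using 2
    ext x; simp
  rwa [h4] at h3

/-! ### Lebesgue spaces of Lusin measurable functions with values in a locally convex space -/

/-- Lebesgue measure on the interval `[a,b]`. -/
def lebesgueIcc (a b : ℝ) : Measure (Icc a b) := Measure.comap (↑) (volume : Measure ℝ)

/-- The vector space `ℒ^p([a,b],E)` of Lusin measurable functions `γ : [a,b] → E` such that
`q ∘ γ` is in the scalar `ℒ^p([a,b])` for every continuous seminorm `q` on `E`. -/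
def CurlyLp (p : ℝ≥0∞) (a b : ℝ) (E : Type u) [AddCommGroup E] [Module ℝ E] [TopologicalSpace E]
    [IsTopologicalAddGroup E] [ContinuousSMul ℝ E] : Submodule ℝ (Icc a b → E) where
  carrier := {γ | LusinMeasurable (lebesgueIcc a b) γ ∧
    ∀ q : Seminorm ℝ E, Continuous q → MemLp (fun t => q (γ t)) p (lebesgueIcc a b)}
  zero_mem' := ⟨.of_continuous continuous_const, fun q _ => by simp⟩
  add_mem' := by
    rintro γ η ⟨h1, h2⟩ ⟨h3, h4⟩
    have h5 : LusinMeasurable (lebesgueIcc a b) (γ + η) :=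
      LusinMeasurable.comp (g := fun z : E × E => z.1 + z.2) continuous_add (h1.prodMk h3)
    refine ⟨h5, fun q hq => ((h2 q hq).add (h4 q hq)).mono' (h5.comp hq).aestronglyMeasurable
      (ae_of_all _ fun t => ?_)⟩
    rw [Real.norm_of_nonneg (apply_nonneg q _)]
    exact map_add_le_add q _ _
  smul_mem' := by
    rintro c γ ⟨h1, h2⟩
    refine ⟨LusinMeasurable.comp (g := fun z : E => c • z) (continuous_const_smul c) h1, fun q hq => ?_⟩
    have h : (fun t => q ((c • γ) t)) = fun t => ‖c‖ * q (γ t) := by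
      ext t; exact map_smul_eq_mul q c (γ t)
    rw [h]
    exact (h2 q hq).const_mul _

section LebesgueSpace

variable {p : ℝ≥0∞} {a b : ℝ} {E : Type u} [AddCommGroup E] [Module ℝ E] [TopologicalSpace E]
    [IsTopologicalAddGroup E] [ContinuousSMul ℝ E]

/-- The seminorm `‖γ‖_{ℒ^p,q} = ‖q ∘ γ‖_{ℒ^p}` on `ℒ^p([a,b],E)`. -/
def CurlyLp.seminorm [Fact (1 ≤ p)] (q : {q : Seminorm ℝ E // Continuous q}) :
    Seminorm ℝ (CurlyLp p a b E) :=
  Seminorm.of (fun γ => (eLpNorm (fun t => q.1 (γ.1 t)) p (lebesgueIcc a b)).toReal)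
    (by
      intro γ η
      have h1 := γ.2.2 q.1 q.2
      have h2 := η.2.2 q.1 q.2
      rw [← ENNReal.toReal_add h1.2.ne h2.2.ne]
      refine ENNReal.toReal_mono (ENNReal.add_ne_top.2 ⟨h1.2.ne, h2.2.ne⟩) ?_
      refine le_trans (eLpNorm_mono_real
        (g := (fun t => q.1 (γ.1 t)) + fun t => q.1 (η.1 t)) fun t => ?_)
        (eLpNorm_add_le h1.1 h2.1 Fact.out)
      rw [Real.norm_of_nonneg (apply_nonneg q.1 _)]
      exact map_add_le_add q.1 (γ.1 t) (η.1 t))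
    (by
      intro c γ
      have h : (fun t => q.1 ((c • γ).1 t)) = ‖c‖ • fun t => q.1 (γ.1 t) := by
        ext t; exact map_smul_eq_mul q.1 c (γ.1 t)
      rw [h, eLpNorm_const_smul, ENNReal.toReal_mul]
      simp)

variable (p a b E) in
/-- The subspace `N_p` of functions in `ℒ^p([a,b],E)` that vanish almost everywhere. -/
def CurlyLp.null : Submodule ℝ (CurlyLp p a b E) where
  carrier := {γ | ∀ᵐ t ∂lebesgueIcc a b, γ.1 t = 0}
  zero_mem' := ae_of_all _ fun _ => rfl
  add_mem' := by
    intro γ η (h1 : ∀ᵐ t ∂lebesgueIcc a b, γ.1 t = 0) (h2 : ∀ᵐ t ∂lebesgueIcc a b, η.1 t = 0)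
    change ∀ᵐ t ∂lebesgueIcc a b, γ.1 t + η.1 t = 0
    filter_upwards [h1, h2] with t h3 h4
    rw [h3, h4, add_zero]
  smul_mem' := by
    intro c γ (h1 : ∀ᵐ t ∂lebesgueIcc a b, γ.1 t = 0)
    change ∀ᵐ t ∂lebesgueIcc a b, c • γ.1 t = 0
    filter_upwards [h1] with t h3
    rw [h3, smul_zero]

variable (p a b E) in
/-- The Lebesgue space `L^p([a,b],E) = ℒ^p([a,b],E) / N_p`. -/
def LebesgueLp : Type u := CurlyLp p a b E ⧸ CurlyLp.null p a b E

namespace LebesgueLp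

instance : AddCommGroup (LebesgueLp p a b E) :=
  inferInstanceAs (AddCommGroup (CurlyLp p a b E ⧸ CurlyLp.null p a b E))

instance : Module ℝ (LebesgueLp p a b E) :=
  inferInstanceAs (Module ℝ (CurlyLp p a b E ⧸ CurlyLp.null p a b E))

/-- The class `[γ]` of a function, as a linear map. -/
def mk : CurlyLp p a b E →ₗ[ℝ] LebesgueLp p a b E := (CurlyLp.null p a b E).mkQ

theorem mk_surjective : Function.Surjective (mk : CurlyLp p a b E → LebesgueLp p a b E) :=
  Submodule.mkQ_surjective _

theorem mk_eq_mk {γ η : CurlyLp p a b E} : mk γ = mk η ↔ ∀ᵐ t ∂lebesgueIcc a b, γ.1 t = η.1 t := by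
  refine (Submodule.Quotient.eq (CurlyLp.null p a b E)).trans ?_
  change (∀ᵐ t ∂lebesgueIcc a b, γ.1 t - η.1 t = 0) ↔ _
  simp only [sub_eq_zero]

/-- The seminorm `‖[γ]‖_{L^p,q} = ‖γ‖_{ℒ^p,q}` on `L^p([a,b],E)`, see `seminorm_mk`. -/
def seminorm [Fact (1 ≤ p)] (q : {q : Seminorm ℝ E // Continuous q}) :
    Seminorm ℝ (LebesgueLp p a b E) :=
  Seminorm.of
    (Quotient.lift (s := (CurlyLp.null p a b E).quotientRel) (CurlyLp.seminorm q)
      (by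
        intro γ η h
        have h1 : mk γ = mk η := Quotient.sound h
        rw [mk_eq_mk] at h1
        change (eLpNorm _ p (lebesgueIcc a b)).toReal = (eLpNorm _ p (lebesgueIcc a b)).toReal
        congr 1
        refine eLpNorm_congr_ae ?_
        filter_upwards [h1] with t ht
        rw [ht]))
    (by
      intro x y
      obtain ⟨γ, rfl⟩ := mk_surjective x
      obtain ⟨η, rfl⟩ := mk_surjective y
      exact map_add_le_add (CurlyLp.seminorm q) γ η)
    (by
      intro c x
      obtain ⟨γ, rfl⟩ := mk_surjective x
      exact map_smul_eq_mul (CurlyLp.seminorm q) c γ)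

theorem seminorm_mk [Fact (1 ≤ p)] (q : {q : Seminorm ℝ E // Continuous q})
    (γ : CurlyLp p a b E) :
    seminorm q (mk γ) = (eLpNorm (fun t => q.1 (γ.1 t)) p (lebesgueIcc a b)).toReal := rfl

variable (p a b E) in
/-- The family of the seminorms `‖.‖_{L^p,q}`, where `q` ranges over all continuous seminorms. -/
def seminormFamily [Fact (1 ≤ p)] :
    SeminormFamily ℝ (LebesgueLp p a b E) {q : Seminorm ℝ E // Continuous q} := seminorm

instance : Nonempty {q : Seminorm ℝ E // Continuous q} := ⟨⟨0, continuous_const⟩⟩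

/-- The locally convex topology on `L^p([a,b],E)` defined by the seminorms `‖.‖_{L^p,q}`. -/
instance [Fact (1 ≤ p)] : TopologicalSpace (LebesgueLp p a b E) :=
  (seminormFamily p a b E).moduleFilterBasis.topology

theorem withSeminorms [Fact (1 ≤ p)] : WithSeminorms (seminormFamily p a b E) := ⟨rfl⟩

instance [Fact (1 ≤ p)] : IsTopologicalAddGroup (LebesgueLp p a b E) :=
  withSeminorms.topologicalAddGroup

instance [Fact (1 ≤ p)] : ContinuousSMul ℝ (LebesgueLp p a b E) := withSeminorms.continuousSMul

instance [Fact (1 ≤ p)] : LocallyConvexSpace ℝ (LebesgueLp p a b E) :=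
  withSeminorms.toLocallyConvexSpace

/-- `L^p([a,b],E)` is Hausdorff. -/
instance [Fact (1 ≤ p)] [LocallyConvexSpace ℝ E] [T2Space E] : T2Space (LebesgueLp p a b E) := by
  have : T1Space (LebesgueLp p a b E) := by
    refine withSeminorms.T1_of_separating fun x hx => ?_
    by_contra! hcon
    obtain ⟨γ, rfl⟩ := mk_surjective x
    apply hx
    rw [← map_zero mk, mk_eq_mk]
    have h0 : ∀ q : {q : Seminorm ℝ E // Continuous q}, lebesgueIcc a b {t | q.1 (γ.1 t) ≠ 0} = 0 := by
      intro q
      have h := hcon q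
      change seminorm q (mk γ) = 0 at h
      have h2 := γ.2.2 q.1 q.2
      have hp : p ≠ 0 := (zero_lt_one.trans_le (Fact.out : 1 ≤ p)).ne'
      rw [seminorm_mk, ENNReal.toReal_eq_zero_iff, or_iff_left h2.2.ne,
        eLpNorm_eq_zero_iff h2.1 hp] at h
      exact ae_iff.1 h
    obtain ⟨A, h1, h2⟩ := γ.2.1 univ isCompact_univ
    change ∀ᵐ t ∂lebesgueIcc a b, γ.1 t = 0
    rw [ae_iff]
    refine measure_mono_null (t := (univ \ ⋃ n, A n) ∪ ⋃ n, {t ∈ A n | γ.1 t ≠ 0}) ?_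
      (measure_union_null h2 (measure_iUnion_null fun n => ?_))
    · intro t ht
      by_cases h : t ∈ ⋃ n, A n
      · obtain ⟨n, hn⟩ := mem_iUnion.1 h
        exact Or.inr (mem_iUnion.2 ⟨n, hn, ht⟩)
      · exact Or.inl ⟨trivial, h⟩
    · refine measure_null_of_locally_null _ fun t ht => ?_
      obtain ⟨q, hq⟩ := (with_gaugeSeminormFamily (𝕜 := ℝ) (E := E)).separating_of_T1 _ ht.2
      have hqc : Continuous (gaugeSeminormFamily ℝ E q) :=
        with_gaugeSeminormFamily.continuous_seminorm q
      refine ⟨_, ?_, h0 ⟨_, hqc⟩⟩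
      have hc : ContinuousWithinAt (fun s => gaugeSeminormFamily ℝ E q (γ.1 s)) (A n) t :=
        hqc.continuousAt.comp_continuousWithinAt ((h1 n).2.2 t ht.1)
      exact nhdsWithin_mono _ (fun s hs => hs.1) (hc.eventually_ne hq)
  infer_instance

end LebesgueLp

end LebesgueSpace

/-- The set `C([a,b],V)` of continuous maps with values in `V`, as a subset of `C([a,b],E)`; the
compact-open topology of the latter is the topology of uniform convergence. -/
def contMapsInto {E₁ : Type*} [TopologicalSpace E₁] (a b : ℝ) (V : Set E₁) :
    Set C(Icc a b, E₁) :=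
  {η | ∀ t, η t ∈ V}

theorem isOpen_contMapsInto {E₁ : Type*} [TopologicalSpace E₁] (a b : ℝ) {V : Set E₁}
    (hV : IsOpen V) : IsOpen (contMapsInto a b V) := by
  simpa [contMapsInto, MapsTo] using
    ContinuousMap.isOpen_setOfPred_mapsTo (X := Icc a b) isCompact_univ hV

end

noncomputable section

/-! ### Continuous seminorms and a mean value inequality -/

section Seminorms

variable {E : Type*} [AddCommGroup E] [Module ℝ E]

/-! Linearity in the second argument turns continuity of `f` into seminorm estimates. Let `g ((x,
y), v)` be the derivative of `f` at `(x, v)` in the direction `(y, 0)`. Continuity at zero together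
with homogeneity gives `q (f (z, v)) ≤ p v` and `q (g ((z, y), v)) ≤ r y * p v` for `z` near a
point. These bounds are uniform around the compact image of a continuous curve
(`exists_compact_bound`), and the mean value inequality yields `q (f (z, v) - f (x, v)) ≤ r (z - x)
* p v` (`exists_lipschitz_bound`). Taking `L^p`-norms of these pointwise inequalities shows that
`Θ_f` is well defined and continuous, for all `p` at once.

For the derivative, `g` is again linear in `v`, so the Lipschitz estimate for `g` controls the
difference quotients of `f` (`exists_slope_bound`). This gives `dΘ_f ((η, x), (η₁, x₁)) = Θ_g ((η,
η₁), x) + Θ_f (η, x₁)`. Both summands are superposition operators of the same kind composed with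
continuous linear maps, so induction on the order applies, with `E₁` replaced by `E₁ × E₁` for `g`.
Each step costs one derivative of `f`, and continuity of `Θ_f` already uses a first one. -/

theorem exists_continuous_seminorm_lt_one_subset [TopologicalSpace E] [IsTopologicalAddGroup E]
    [ContinuousSMul ℝ E] [LocallyConvexSpace ℝ E] {U : Set E} (hU : U ∈ 𝓝 (0 : E)) :
    ∃ r : Seminorm ℝ E, Continuous r ∧ ∀ x, r x < 1 → x ∈ U := by
  obtain ⟨s, hs, hsU⟩ := (nhds_hasBasis_absConvex_open ℝ E).mem_iff.1 hU
  refine ⟨gaugeSeminormFamily ℝ E ⟨s, hs⟩, with_gaugeSeminormFamily.continuous_seminorm _,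
    fun x hx => hsU ?_⟩
  have h := gaugeSeminormFamily_ball (𝕜 := ℝ) (E := E) ⟨s, hs⟩
  have h2 : x ∈ (gaugeSeminormFamily ℝ E ⟨s, hs⟩).ball 0 1 := (Seminorm.mem_ball_zero _).2 hx
  rw [h] at h2
  exact h2

/-- A positively homogeneous function bounded by `C` on the unit ball of a seminorm `r` is bounded
by `C * r`. -/
theorem Seminorm.le_mul_of_bound_of_lt_one (r : Seminorm ℝ E) {φ : E → ℝ} {C : ℝ}
    (hφ : ∀ c : ℝ, 0 < c → ∀ x, φ (c • x) = c * φ x) (h : ∀ x, r x < 1 → φ x ≤ C) (x : E) :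
    φ x ≤ C * r x := by
  have key : ∀ ε : ℝ, 0 < ε → φ x ≤ C * (r x + ε) := by
    intro ε hε
    have h0 : 0 < r x + ε := add_pos_of_nonneg_of_pos (apply_nonneg r x) hε
    have h1 := h ((r x + ε)⁻¹ • x) (by
      rw [map_smul_eq_mul, Real.norm_of_nonneg (inv_nonneg.2 h0.le), inv_mul_lt_iff₀ h0]
      linarith)
    rwa [hφ _ (inv_pos.2 h0), inv_mul_le_iff₀ h0, mul_comm] at h1
  have ht : Tendsto (fun ε : ℝ => C * (r x + ε)) (𝓝[>] 0) (𝓝 (C * (r x + 0))) :=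
    (Continuous.tendsto (by fun_prop) 0).mono_left nhdsWithin_le_nhds
  rw [add_zero] at ht
  exact ge_of_tendsto ht (eventually_mem_nhdsWithin.mono fun ε hε => key ε hε)

/-- Hahn–Banach: extend `c • x ↦ c * q x` from the line through `x`, dominated by `q`. It reduces
the mean value inequality to scalar functions. -/
theorem Seminorm.exists_linearMap_le (q : Seminorm ℝ E) (x : E) :
    ∃ l : E →ₗ[ℝ] ℝ, l x = q x ∧ ∀ y, |l y| ≤ q y := by
  by_cases hx : q x = 0
  · exact ⟨0, by simp [hx], fun y => by simp⟩
  have hx0 : x ≠ 0 := fun h => hx (by rw [h, map_zero])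
  obtain ⟨l, hl, hle⟩ := exists_extension_of_le_sublinear (LinearPMap.mkSpanSingleton x (q x) hx0) q
    (fun c hc y => by rw [map_smul_eq_mul, Real.norm_of_nonneg hc.le])
    (map_add_le_add q) (by
      rintro ⟨y, hy⟩
      obtain ⟨c, rfl⟩ := Submodule.mem_span_singleton.1 hy
      refine (LinearPMap.mkSpanSingleton'_apply x (q x) _ c hy).le.trans ?_
      rw [smul_eq_mul, map_smul_eq_mul]
      exact mul_le_mul_of_nonneg_right (le_abs_self c) (apply_nonneg q x))
  refine ⟨l, ?_, fun y => abs_le.2 ⟨?_, hle y⟩⟩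
  · exact (hl ⟨x, Submodule.mem_span_singleton_self x⟩).trans
      (LinearPMap.mkSpanSingleton_apply (σ := RingHom.id ℝ) ℝ ℝ hx0 (q x))
  · have h := hle (-y)
    rw [map_neg, map_neg_eq_map] at h
    linarith

/-- Apply the scalar mean value inequality to `l ∘ h`, where `l` is dominated by `q` and attains it
at `h 1 - h 0`. No integral is formed, so no completeness is needed. -/
theorem Seminorm.sub_le_of_tendsto_slope [TopologicalSpace E] [IsTopologicalAddGroup E] {q : Seminorm ℝ E}
    (hq : Continuous q) {h h' : ℝ → E} {C : ℝ}
    (hd : ∀ s ∈ Icc (0 : ℝ) 1,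
      Tendsto (fun t : ℝ => t⁻¹ • (h (s + t) - h s)) (𝓝[≠] 0) (𝓝 (h' s)))
    (hC : ∀ s ∈ Icc (0 : ℝ) 1, q (h' s) ≤ C) : q (h 1 - h 0) ≤ C := by
  obtain ⟨l, hl, hle⟩ := q.exists_linearMap_le (h 1 - h 0)
  have hlc : Continuous l := by
    refine continuous_of_continuousAt_zero l ?_
    have h0 : Tendsto q (𝓝 0) (𝓝 0) := by simpa using hq.tendsto 0
    rw [ContinuousAt, map_zero]
    exact squeeze_zero_norm hle h0
  have h1 := norm_image_sub_le_of_norm_deriv_le_segment_01' (f := fun s => l (h s))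
    (f' := fun s => l (h' s)) (C := C) (fun s hs => by
      refine HasDerivAt.hasDerivWithinAt (hasDerivAt_iff_tendsto_slope_zero.2 ?_)
      have h2 := (hlc.tendsto _).comp (hd s hs)
      refine h2.congr fun t => ?_
      simp) fun s hs => (hle _).trans (hC s (Ico_subset_Icc_self hs))
  rw [← hl, map_sub]
  exact (le_abs_self _).trans h1

end Seminorms

/-! ### Maps which are `C¹` and linear in the second argument -/

section PartialDeriv

variable {E₁ E₂ F : Type*}
    [AddCommGroup E₁] [Module ℝ E₁] [TopologicalSpace E₁]
    [AddCommGroup E₂] [Module ℝ E₂] [TopologicalSpace E₂]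
    [AddCommGroup F] [Module ℝ F] [TopologicalSpace F]

/-- `f : V × E₂ → F` is continuous and linear in its second argument, and has the continuous partial
derivative `g ((x, y), v) = lim_{h → 0} h⁻¹ (f (x + h y, v) - f (x, v))`. -/
structure HasContPartialDeriv (V : Set E₁) (f : E₁ × E₂ → F) (g : (E₁ × E₁) × E₂ → F) : Prop where
  isLinearMap : ∀ x ∈ V, IsLinearMap ℝ fun v : E₂ => f (x, v)
  continuousOn : ContinuousOn f (V ×ˢ univ)
  continuousOn_deriv : ContinuousOn g ((V ×ˢ (univ : Set E₁)) ×ˢ (univ : Set E₂))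
  tendsto : ∀ x ∈ V, ∀ y v, Tendsto (fun h : ℝ => h⁻¹ • (f (x + h • y, v) - f (x, v))) (𝓝[≠] 0)
    (𝓝 (g ((x, y), v)))

theorem eventually_add_smul_mem [ContinuousAdd E₁] [ContinuousSMul ℝ E₁] {V : Set E₁}
    (hV : IsOpen V) {x : E₁} (hx : x ∈ V) (y : E₁) : ∀ᶠ h : ℝ in 𝓝[≠] 0, x + h • y ∈ V := by
  have h : Tendsto (fun h : ℝ => x + h • y) (𝓝 0) (𝓝 x) := by
    have := Continuous.tendsto (f := fun h : ℝ => x + h • y) (by fun_prop) 0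
    simpa using this
  exact nhdsWithin_le_nhds (h.eventually_mem (hV.mem_nhds hx))

namespace HasContPartialDeriv

variable {V : Set E₁} {f : E₁ × E₂ → F} {g : (E₁ × E₁) × E₂ → F}

/-- The difference quotients are linear in `v` as soon as `x + h • y ∈ V`; linearity passes to their
limit, which is unique because `F` is Hausdorff. -/
theorem isLinearMap_deriv [IsTopologicalAddGroup E₁] [ContinuousSMul ℝ E₁]
    [IsTopologicalAddGroup F] [ContinuousSMul ℝ F] [T2Space F]
    (H : HasContPartialDeriv V f g) (hV : IsOpen V) {x : E₁} (hx : x ∈ V) (y : E₁) :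
    IsLinearMap ℝ fun v : E₂ => g ((x, y), v) where
  map_add v w := by
    refine tendsto_nhds_unique (H.tendsto x hx y (v + w)) ?_
    refine ((H.tendsto x hx y v).add (H.tendsto x hx y w)).congr' ?_
    filter_upwards [eventually_add_smul_mem hV hx y] with h hh
    rw [(H.isLinearMap _ hh).map_add, (H.isLinearMap _ hx).map_add, ← smul_add]
    congr 1
    abel
  map_smul c v := by
    refine tendsto_nhds_unique (H.tendsto x hx y (c • v)) ?_
    refine ((H.tendsto x hx y v).const_smul c).congr' ?_
    filter_upwards [eventually_add_smul_mem hV hx y] with h hh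
    rw [(H.isLinearMap _ hh).map_smul, (H.isLinearMap _ hx).map_smul, ← smul_sub, smul_comm]

/-- Substitute `h * c` for `h`. Homogeneity in `y` is all the estimates need; additivity in `y` is
never used. -/
theorem deriv_smul [ContinuousSMul ℝ F] [IsTopologicalAddGroup F] [T2Space F]
    (H : HasContPartialDeriv V f g) {x : E₁} (hx : x ∈ V) {c : ℝ} (hc : c ≠ 0) (y : E₁) (v : E₂) :
    g ((x, c • y), v) = c • g ((x, y), v) := by
  refine tendsto_nhds_unique (H.tendsto x hx (c • y) v) ?_
  have hm : Tendsto (fun h : ℝ => h * c) (𝓝[≠] 0) (𝓝[≠] 0) := by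
    refine tendsto_nhdsWithin_iff.2 ⟨?_, ?_⟩
    · have := Continuous.tendsto (f := fun h : ℝ => h * c) (by fun_prop) 0
      rw [zero_mul] at this
      exact this.mono_left nhdsWithin_le_nhds
    · exact eventually_mem_nhdsWithin.mono fun h hh => mul_ne_zero hh hc
  refine (((H.tendsto x hx y v).comp hm).const_smul c).congr fun h => ?_
  simp only [Function.comp_apply, smul_smul, mul_inv]
  congr 1
  field_simp

variable [IsTopologicalAddGroup E₁] [ContinuousSMul ℝ E₁] [LocallyConvexSpace ℝ E₁]
    [IsTopologicalAddGroup E₂] [ContinuousSMul ℝ E₂] [LocallyConvexSpace ℝ E₂]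
    [IsTopologicalAddGroup F] [ContinuousSMul ℝ F] [T2Space F]

/-- Near a point, `f` and its partial derivative are bounded by products of seminorms. -/
theorem exists_local_bound (H : HasContPartialDeriv V f g) (hV : IsOpen V) {x : E₁} (hx : x ∈ V)
    {q : Seminorm ℝ F} (hq : Continuous q) :
    ∃ r : Seminorm ℝ E₁, Continuous r ∧ ∃ p : Seminorm ℝ E₂, Continuous p ∧
      ∀ z, r (z - x) < 1 → z ∈ V ∧ ∀ v, q (f (z, v)) ≤ p v ∧
        ∀ y, q (g ((z, y), v)) ≤ r y * p v := by
  have hf0 : f (x, 0) = 0 := (H.isLinearMap x hx).map_zero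
  have hg0 : g ((x, 0), 0) = 0 := (H.isLinearMap_deriv hV hx 0).map_zero
  have h1 : {z | q (f z) < 1} ∈ 𝓝 (x, (0 : E₂)) := by
    have hc := H.continuousOn.continuousAt ((hV.prod isOpen_univ).mem_nhds
      (mk_mem_prod hx (mem_univ (0 : E₂))))
    refine (hq.continuousAt.comp hc).eventually_lt continuousAt_const ?_
    simp [hf0]
  have h2 : {z | q (g z) < 1} ∈ 𝓝 ((x, (0 : E₁)), (0 : E₂)) := by
    have hc := H.continuousOn_deriv.continuousAt (((hV.prod isOpen_univ).prod isOpen_univ).mem_nhds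
      (mk_mem_prod (mk_mem_prod hx (mem_univ (0 : E₁))) (mem_univ (0 : E₂))))
    refine (hq.continuousAt.comp hc).eventually_lt continuousAt_const ?_
    simp [hg0]
  obtain ⟨A, hA, B, hB, hAB⟩ := mem_nhds_prod_iff.1 h1
  obtain ⟨D, hD, B', hB', hDB⟩ := mem_nhds_prod_iff.1 h2
  obtain ⟨A', hA', C, hC, hAC⟩ := mem_nhds_prod_iff.1 hD
  obtain ⟨p, hp, hpB⟩ := exists_continuous_seminorm_lt_one_subset (inter_mem hB hB')
  have hx' : (fun z => z + x) ⁻¹' (A ∩ A' ∩ V) ∈ 𝓝 (0 : E₁) := by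
    refine (continuous_add_const x).continuousAt.preimage_mem_nhds ?_
    rw [zero_add]
    exact inter_mem (inter_mem hA hA') (hV.mem_nhds hx)
  -- One seminorm `r` plays two roles: it restricts the base point `z - x` and it measures the
  -- direction `y`.
  obtain ⟨r, hr, hrC⟩ := exists_continuous_seminorm_lt_one_subset (inter_mem hx' hC)
  refine ⟨r, hr, p, hp, fun z hz => ?_⟩
  obtain ⟨⟨hzA, hzA'⟩, hzV⟩ := (hrC _ hz).1
  simp only [sub_add_cancel] at hzA hzA' hzV
  refine ⟨hzV, fun v => ⟨?_, fun y => ?_⟩⟩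
  · have := p.le_mul_of_bound_of_lt_one (φ := fun v => q (f (z, v)))
      (fun c hc v => by
        rw [(H.isLinearMap z hzV).map_smul, map_smul_eq_mul, Real.norm_of_nonneg hc.le])
      (fun v hv => (hAB (mk_mem_prod hzA (hpB v hv).1)).le) v
    rwa [one_mul] at this
  -- Homogeneity is used twice: for fixed `v` with `p v < 1` the bound 1 improves to `r y`, which
  -- then serves as the constant for the scaling in `v`.
  · refine p.le_mul_of_bound_of_lt_one (φ := fun v => q (g ((z, y), v)))
      (fun c hc v => by
        rw [(H.isLinearMap_deriv hV hzV y).map_smul, map_smul_eq_mul, Real.norm_of_nonneg hc.le])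
      (fun v hv => ?_) v
    have := r.le_mul_of_bound_of_lt_one (φ := fun y => q (g ((z, y), v)))
      (fun c hc y => by
        rw [H.deriv_smul hzV hc.ne', map_smul_eq_mul, Real.norm_of_nonneg hc.le])
      (fun y hy => (hDB (mk_mem_prod (hAC (mk_mem_prod hzA' (hrC y hy).2)) (hpB v hv).2)).le) y
    rwa [one_mul] at this

/-- Uniform version of `exists_local_bound` around a compact set. -/
theorem exists_compact_bound (H : HasContPartialDeriv V f g) (hV : IsOpen V) {K : Set E₁}
    (hK : IsCompact K) (hKV : K ⊆ V) {q : Seminorm ℝ F} (hq : Continuous q) :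
    ∃ r : Seminorm ℝ E₁, Continuous r ∧ ∃ p : Seminorm ℝ E₂, Continuous p ∧
      ∀ x ∈ K, ∀ z, r (z - x) < 1 → z ∈ V ∧ ∀ v, q (f (z, v)) ≤ p v ∧
        ∀ y, q (g ((z, y), v)) ≤ r y * p v := by
  refine hK.induction_on (p := fun K => ∃ r : Seminorm ℝ E₁, Continuous r ∧
    ∃ p : Seminorm ℝ E₂, Continuous p ∧ ∀ x ∈ K, ∀ z, r (z - x) < 1 → z ∈ V ∧
      ∀ v, q (f (z, v)) ≤ p v ∧ ∀ y, q (g ((z, y), v)) ≤ r y * p v) ?_ ?_ ?_ ?_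
  · exact ⟨0, continuous_const, 0, continuous_const, fun x hx => hx.elim⟩
  · intro s t hst h
    obtain ⟨r, hr, p, hp, h⟩ := h
    exact ⟨r, hr, p, hp, fun x hx => h x (hst hx)⟩
  · intro s t hs ht
    obtain ⟨r, hr, p, hp, h⟩ := hs
    obtain ⟨r', hr', p', hp', h'⟩ := ht
    have h1 : ∀ y, r y ≤ (r + r') y := fun y => le_add_of_nonneg_right (apply_nonneg r' y)
    have h2 : ∀ y, r' y ≤ (r + r') y := fun y => le_add_of_nonneg_left (apply_nonneg r y)
    have h3 : ∀ y, p y ≤ (p + p') y := fun y => le_add_of_nonneg_right (apply_nonneg p' y)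
    have h4 : ∀ y, p' y ≤ (p + p') y := fun y => le_add_of_nonneg_left (apply_nonneg p y)
    refine ⟨r + r', hr.add hr', p + p', hp.add hp', ?_⟩
    rintro x (hx | hx) z hz
    · obtain ⟨hzV, hb⟩ := h x hx z ((h1 _).trans_lt hz)
      exact ⟨hzV, fun v => ⟨((hb v).1).trans (h3 v), fun y => ((hb v).2 y).trans
        (mul_le_mul (h1 y) (h3 v) (apply_nonneg p v) (apply_nonneg _ y))⟩⟩
    · obtain ⟨hzV, hb⟩ := h' x hx z ((h2 _).trans_lt hz)
      exact ⟨hzV, fun v => ⟨((hb v).1).trans (h4 v), fun y => ((hb v).2 y).trans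
        (mul_le_mul (h2 y) (h4 v) (apply_nonneg p' v) (apply_nonneg _ y))⟩⟩
  · intro x hx
    obtain ⟨r, hr, p, hp, h⟩ := H.exists_local_bound hV (hKV hx) hq
    -- Halving the radius and doubling the seminorm keeps the unit ball of `r + r` around each such
    -- `w` inside the unit ball of `r` around `x`.
    refine ⟨{w | r (w - x) < 1 / 2}, mem_nhdsWithin_of_mem_nhds ?_, r + r, hr.add hr, p, hp, ?_⟩
    · refine (isOpen_lt (by fun_prop) continuous_const).mem_nhds ?_
      simp
    · intro w hw z hz
      change r (w - x) < 1 / 2 at hw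
      change r (z - w) + r (z - w) < 1 at hz
      have h1 : r (z - x) < 1 := by
        have := map_add_le_add r (z - w) (w - x)
        rw [sub_add_sub_cancel] at this
        linarith
      obtain ⟨hzV, hb⟩ := h z h1
      refine ⟨hzV, fun v => ⟨(hb v).1, fun y => ((hb v).2 y).trans ?_⟩⟩
      exact mul_le_mul_of_nonneg_right (le_add_of_nonneg_right (apply_nonneg r y))
        (apply_nonneg p v)

/-- Around a compact set, `f` is Lipschitz in the first argument with respect to seminorms. -/
theorem exists_lipschitz_bound (H : HasContPartialDeriv V f g) (hV : IsOpen V) {K : Set E₁}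
    (hK : IsCompact K) (hKV : K ⊆ V) {q : Seminorm ℝ F} (hq : Continuous q) :
    ∃ r : Seminorm ℝ E₁, Continuous r ∧ ∃ p : Seminorm ℝ E₂, Continuous p ∧
      ∀ x ∈ K, ∀ z, r (z - x) < 1 → z ∈ V ∧ ∀ v, q (f (z, v)) ≤ p v ∧
        q (f (z, v) - f (x, v)) ≤ r (z - x) * p v := by
  obtain ⟨r, hr, p, hp, h⟩ := H.exists_compact_bound hV hK hKV hq
  refine ⟨r, hr, p, hp, fun x hx z hz => ⟨(h x hx z hz).1, fun v => ⟨((h x hx z hz).2 v).1, ?_⟩⟩⟩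
  have hs : ∀ s ∈ Icc (0 : ℝ) 1, r (x + s • (z - x) - x) < 1 := by
    intro s hs
    rw [add_sub_cancel_left, map_smul_eq_mul, Real.norm_of_nonneg hs.1]
    exact (mul_le_of_le_one_left (apply_nonneg r _) hs.2).trans_lt hz
  have := Seminorm.sub_le_of_tendsto_slope hq (h := fun s => f (x + s • (z - x), v))
    (h' := fun s => g ((x + s • (z - x), z - x), v)) (C := r (z - x) * p v)
    (fun s hs' => by
      refine (H.tendsto _ (h x hx _ (hs s hs')).1 (z - x) v).congr fun t => ?_
      rw [add_assoc, ← add_smul])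
    (fun s hs' => ((h x hx _ (hs s hs')).2 v).2 _)
  simpa using this

/-- The difference quotients of `f` converge to the partial derivative uniformly along
compact sets, with an estimate in terms of seminorms. -/
theorem exists_slope_bound {g' : ((E₁ × E₁) × (E₁ × E₁)) × E₂ → F}
    (H : HasContPartialDeriv V f g) (H' : HasContPartialDeriv (V ×ˢ (univ : Set E₁)) g g')
    (hV : IsOpen V) {K : Set (E₁ × E₁)} (hK : IsCompact K) (hKV : K ⊆ V ×ˢ (univ : Set E₁))
    {q : Seminorm ℝ F} (hq : Continuous q) :
    ∃ r : Seminorm ℝ E₁, Continuous r ∧ ∃ p : Seminorm ℝ E₂, Continuous p ∧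
      ∀ x y, (x, y) ∈ K → ∀ h : ℝ, h ≠ 0 → r (h • y) < 1 → ∀ v,
        q (h⁻¹ • (f (x + h • y, v) - f (x, v)) - g ((x, y), v)) ≤ r (h • y) * p v := by
  -- The Lipschitz estimate is applied to `g`. Only the base point moves, from `(x, y)` to `(x + s •
  -- h • y, y)`, so `r` is needed only on the first factor.
  obtain ⟨r, hr, p, hp, hb⟩ := H'.exists_lipschitz_bound (hV.prod isOpen_univ) hK hKV hq
  refine ⟨r.comp (LinearMap.inl ℝ E₁ E₁), hr.comp (Continuous.prodMk_left 0), p, hp,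
    fun x y hxy h hh hlt v => ?_⟩
  change r (h • y, 0) < 1 at hlt
  change _ ≤ r (h • y, 0) * p v
  have hle : ∀ s ∈ Icc (0 : ℝ) 1, r ((x + s • h • y, y) - (x, y)) ≤ r (h • y, 0) := by
    intro s hs
    have : (x + s • h • y, y) - (x, y) = s • ((h • y, 0) : E₁ × E₁) := by simp
    rw [this, map_smul_eq_mul, Real.norm_of_nonneg hs.1]
    exact mul_le_of_le_one_left (apply_nonneg r _) hs.2
  -- The increment of this curve over `[0, 1]` is the error to be estimated; its derivative is the
  -- variation of `g` along the segment.
  have := Seminorm.sub_le_of_tendsto_slope hq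
    (h := fun s => h⁻¹ • f (x + s • h • y, v) - s • g ((x, y), v))
    (h' := fun s => g ((x + s • h • y, y), v) - g ((x, y), v)) (C := r (h • y, 0) * p v)
    (fun s hs => by
      have hm := (hb _ hxy _ ((hle s hs).trans_lt hlt)).1.1
      have ht := ((H.tendsto _ hm (h • y) v).const_smul h⁻¹).sub_const (g ((x, y), v))
      rw [H.deriv_smul hm hh, inv_smul_smul₀ hh] at ht
      refine ht.congr' ?_
      filter_upwards [eventually_mem_nhdsWithin] with t (ht : t ≠ 0)
      rw [add_assoc, ← add_smul, add_smul s t (g _), sub_sub_sub_comm, add_sub_cancel_left (s • g _),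
        ← smul_sub, smul_sub t⁻¹ (h⁻¹ • _), inv_smul_smul₀ ht,
        smul_comm t⁻¹ h⁻¹])
    (fun s hs => ((hb _ hxy _ ((hle s hs).trans_lt hlt)).2 v).2.trans
      (mul_le_mul_of_nonneg_right (hle s hs) (apply_nonneg p v)))
  convert this using 2
  simp only [one_smul, zero_smul, add_zero, sub_zero, smul_sub]
  abel

end HasContPartialDeriv

end PartialDeriv

/-! ### Elementary properties of `C^n`-maps -/

section Bastiani

variable {F : Type v} [AddCommGroup F] [Module ℝ F] [TopologicalSpace F]

theorem BastianiCn.comp_continuousLinearMap (n : ℕ) :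
    ∀ {E : Type u} [AddCommGroup E] [Module ℝ E] [TopologicalSpace E]
      {E' : Type u} [AddCommGroup E'] [Module ℝ E'] [TopologicalSpace E']
      {U : Set E} {U' : Set E'} {f : E → F} (_ : BastianiCn n U f) (L : E' →L[ℝ] E)
      (_ : MapsTo L U' U), BastianiCn n U' fun x => f (L x) := by
  induction n with
  | zero =>
    intro E _ _ _ E' _ _ _ U U' f hf L hL
    exact ContinuousOn.comp hf L.continuous.continuousOn hL
  | succ n ih =>
    intro E _ _ _ E' _ _ _ U U' f hf L hL
    obtain ⟨hc, df, hd, hdf⟩ := hf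
    refine ⟨hc.comp L.continuous.continuousOn hL, fun z => df (L z.1, L z.2), fun x hx y => ?_,
      ih hdf (L.prodMap L) fun z hz => ⟨hL hz.1, mem_univ _⟩⟩
    simpa using hd (L x) (hL hx) (L y)

theorem BastianiCn.add [IsTopologicalAddGroup F] [ContinuousSMul ℝ F] (n : ℕ) :
    ∀ {E : Type u} [AddCommGroup E] [Module ℝ E] [TopologicalSpace E]
      {U : Set E} {f g : E → F} (_ : BastianiCn n U f) (_ : BastianiCn n U g),
      BastianiCn n U fun x => f x + g x := by
  induction n with
  | zero =>
    intro E _ _ _ U f g hf hg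
    exact ContinuousOn.add hf hg
  | succ n ih =>
    intro E _ _ _ U f g hf hg
    obtain ⟨hc, df, hd, hdf⟩ := hf
    obtain ⟨hc', dg, hd', hdg⟩ := hg
    refine ⟨hc.add hc', fun z => df z + dg z, fun x hx y => ?_, ih hdf hdg⟩
    refine ((hd x hx y).add (hd' x hx y)).congr fun h => ?_
    rw [← smul_add, add_sub_add_comm]

end Bastiani

/-! ### Superposition operators on Lebesgue spaces -/

section ContinuousMapAux

variable {E : Type*} [AddCommGroup E] [Module ℝ E] [TopologicalSpace E] [IsTopologicalAddGroup E]
    {a b : ℝ}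

theorem eventually_forall_seminorm_sub_lt {r : Seminorm ℝ E} (hr : Continuous r)
    (η₀ : C(Icc a b, E)) {δ : ℝ} (hδ : 0 < δ) : ∀ᶠ η in 𝓝 η₀, ∀ t, r (η t - η₀ t) < δ := by
  have ho := ContinuousMap.isOpen_setOfPred_mapsTo (X := Icc a b) isCompact_univ
    (isOpen_lt hr (continuous_const (y := δ)))
  have hc : Continuous fun η : C(Icc a b, E) => η - η₀ := by fun_prop
  have h := (ho.preimage hc).mem_nhds (x := η₀) (by intro t _; simpa using hδ)
  filter_upwards [h] with η hη t
  exact hη (mem_univ t)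

/-- The pairing `C([a,b],E) × C([a,b],E) → C([a,b],E × E)`, with additional arguments in a
space `L`. -/
def pairingL (a b : ℝ) (E L : Type*) [AddCommGroup E] [Module ℝ E] [TopologicalSpace E]
    [IsTopologicalAddGroup E] [ContinuousSMul ℝ E] [AddCommGroup L] [Module ℝ L]
    [TopologicalSpace L] :
    ((C(Icc a b, E) × L) × (C(Icc a b, E) × L)) →L[ℝ] C(Icc a b, E × E) × L where
  toFun z := (z.1.1.prodMk z.2.1, z.1.2)
  map_add' _ _ := rfl
  map_smul' _ _ := rfl
  cont := by
    refine Continuous.prodMk ?_ (by fun_prop)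
    refine ContinuousMap.continuous_of_continuous_uncurry _ ?_
    change Continuous fun x : ((C(Icc a b, E) × L) × (C(Icc a b, E) × L)) × Icc a b =>
      (x.1.1.1 x.2, x.1.2.1 x.2)
    fun_prop

end ContinuousMapAux

namespace LebesgueLp

variable {p : ℝ≥0∞} {a b : ℝ}

/-- Uses only monotonicity and homogeneity of the `L^p`-norm, hence covers `p = ∞` as well. -/
theorem seminorm_mk_le [Fact (1 ≤ p)] {E F : Type*}
    [AddCommGroup E] [Module ℝ E] [TopologicalSpace E] [IsTopologicalAddGroup E]
    [ContinuousSMul ℝ E] [AddCommGroup F] [Module ℝ F] [TopologicalSpace F]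
    [IsTopologicalAddGroup F] [ContinuousSMul ℝ F]
    (q : {q : Seminorm ℝ F // Continuous q}) (s : {s : Seminorm ℝ E // Continuous s})
    {γ : CurlyLp p a b F} {γ' : CurlyLp p a b E} {c : ℝ} (hc : 0 ≤ c)
    (h : ∀ t, q.1 (γ.1 t) ≤ c * s.1 (γ'.1 t)) : seminorm q (mk γ) ≤ c * seminorm s (mk γ') := by
  have h2 := γ'.2.2 s.1 s.2
  rw [seminorm_mk, seminorm_mk]
  have h3 : c * (eLpNorm (fun t => s.1 (γ'.1 t)) p (lebesgueIcc a b)).toReal =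
      (eLpNorm (c • fun t => s.1 (γ'.1 t)) p (lebesgueIcc a b)).toReal := by
    rw [eLpNorm_const_smul, ENNReal.toReal_mul]
    simp [abs_of_nonneg hc]
  rw [h3]
  refine ENNReal.toReal_mono (h2.const_smul c).2.ne (eLpNorm_mono_real fun t => ?_)
  rw [Real.norm_of_nonneg (apply_nonneg q.1 _)]
  exact h t

end LebesgueLp

/-- Here `δ < 1` keeps curves where the local estimates hold, and `δ * c < ε` makes those estimates
small. -/
theorem exists_pos_lt_one_mul_lt {c ε : ℝ} (hε : 0 < ε) : ∃ δ : ℝ, 0 < δ ∧ δ < 1 ∧ δ * c < ε := by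
  have h : Tendsto (fun δ : ℝ => δ * c) (𝓝[>] 0) (𝓝 0) := by
    have := Continuous.tendsto (f := fun δ : ℝ => δ * c) (by fun_prop) 0
    rw [zero_mul] at this
    exact this.mono_left nhdsWithin_le_nhds
  obtain ⟨δ, h1, h2⟩ := ((h.eventually_lt_const hε).and (Ioo_mem_nhdsGT zero_lt_one)).exists
  exact ⟨δ, h2.1, h2.2, h1⟩

section Superposition

variable {E₁ : Type*} [AddCommGroup E₁] [Module ℝ E₁] [TopologicalSpace E₁]
    {E₂ : Type*} [AddCommGroup E₂] [Module ℝ E₂] [TopologicalSpace E₂]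
    [IsTopologicalAddGroup E₂] [ContinuousSMul ℝ E₂]
    {F : Type*} [AddCommGroup F] [Module ℝ F] [TopologicalSpace F]
    [IsTopologicalAddGroup F] [ContinuousSMul ℝ F]

open Classical in
/-- The superposition operator `(η, [γ]) ↦ [f ∘ (η, γ)]`, defined to be zero where `f ∘ (η, γ)` is
not in `ℒ^p`. -/
def superposition (p : ℝ≥0∞) (a b : ℝ) (f : E₁ × E₂ → F)
    (z : C(Icc a b, E₁) × LebesgueLp p a b E₂) : LebesgueLp p a b F :=
  if h : (fun t => f (z.1 t, (Function.surjInv LebesgueLp.mk_surjective z.2).1 t)) ∈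
    CurlyLp p a b F then LebesgueLp.mk ⟨_, h⟩ else 0

variable [IsTopologicalAddGroup E₁] [ContinuousSMul ℝ E₁] [LocallyConvexSpace ℝ E₁]
    [LocallyConvexSpace ℝ E₂] [T2Space F]
    {p : ℝ≥0∞} {a b : ℝ} {V : Set E₁} {f : E₁ × E₂ → F} {g : (E₁ × E₁) × E₂ → F}

namespace HasContPartialDeriv

/-- As `η` is continuous, the compact sets witnessing Lusin measurability of `γ` also serve for the
composite. Integrability follows from domination by a seminorm of `γ`. -/
theorem comp_mem_curlyLp (H : HasContPartialDeriv V f g) (hV : IsOpen V) {η : C(Icc a b, E₁)}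
    (hη : η ∈ contMapsInto a b V) (γ : CurlyLp p a b E₂) :
    (fun t => f (η t, γ.1 t)) ∈ CurlyLp p a b F := by
  have hL : LusinMeasurable (lebesgueIcc a b) fun t => f (η t, γ.1 t) := by
    intro K hK
    obtain ⟨A, h1, h2⟩ := γ.2.1 K hK
    exact ⟨A, fun n => ⟨(h1 n).1, (h1 n).2.1,
      H.continuousOn.comp (η.continuous.continuousOn.prodMk (h1 n).2.2)
        fun t _ => ⟨hη t, mem_univ _⟩⟩, h2⟩
  refine ⟨hL, fun q hq => ?_⟩
  obtain ⟨r, hr, s, hs, hb⟩ := H.exists_compact_bound hV (isCompact_range η.continuous)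
    (range_subset_iff.2 hη) hq
  refine (γ.2.2 s hs).mono' (hL.comp hq).aestronglyMeasurable (ae_of_all _ fun t => ?_)
  rw [Real.norm_of_nonneg (apply_nonneg q _)]
  exact ((hb (η t) (mem_range_self t) (η t) (by simp)).2 _).1

theorem superposition_mk (H : HasContPartialDeriv V f g) (hV : IsOpen V) {η : C(Icc a b, E₁)}
    (hη : η ∈ contMapsInto a b V) (γ : CurlyLp p a b E₂) :
    superposition p a b f (η, LebesgueLp.mk γ) =
      LebesgueLp.mk ⟨fun t => f (η t, γ.1 t), H.comp_mem_curlyLp hV hη γ⟩ := by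
  rw [superposition, dif_pos (H.comp_mem_curlyLp hV hη _), LebesgueLp.mk_eq_mk]
  have h := LebesgueLp.mk_eq_mk.1
    (Function.surjInv_eq LebesgueLp.mk_surjective (LebesgueLp.mk γ))
  filter_upwards [h] with t ht
  simp only [ht]

theorem isLinearMap_superposition (H : HasContPartialDeriv V f g) (hV : IsOpen V)
    {η : C(Icc a b, E₁)} (hη : η ∈ contMapsInto a b V) :
    IsLinearMap ℝ fun x : LebesgueLp p a b E₂ => superposition p a b f (η, x) where
  map_add x y := by
    obtain ⟨γ, rfl⟩ := LebesgueLp.mk_surjective x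
    obtain ⟨δ, rfl⟩ := LebesgueLp.mk_surjective y
    rw [← map_add, H.superposition_mk hV hη, H.superposition_mk hV hη, H.superposition_mk hV hη,
      ← map_add]
    congr 2
    funext t
    exact (H.isLinearMap _ (hη t)).map_add _ _
  map_smul c x := by
    obtain ⟨γ, rfl⟩ := LebesgueLp.mk_surjective x
    rw [← map_smul, H.superposition_mk hV hη, H.superposition_mk hV hη, ← map_smul]
    congr 2
    funext t
    exact (H.isLinearMap _ (hη t)).map_smul _ _

/-! ### Seminorm estimates, continuity and directional derivatives of the superposition operator. -/

variable [Fact (1 ≤ p)]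

theorem exists_superposition_bound (H : HasContPartialDeriv V f g) (hV : IsOpen V)
    {η₀ : C(Icc a b, E₁)} (hη₀ : η₀ ∈ contMapsInto a b V) (q : {q : Seminorm ℝ F // Continuous q}) :
    ∃ r : Seminorm ℝ E₁, Continuous r ∧ ∃ s : {s : Seminorm ℝ E₂ // Continuous s},
      ∀ (η : C(Icc a b, E₁)) (δ : ℝ), 0 ≤ δ → δ < 1 → (∀ t, r (η t - η₀ t) ≤ δ) →
        η ∈ contMapsInto a b V ∧ ∀ x : LebesgueLp p a b E₂,
          LebesgueLp.seminorm q (superposition p a b f (η, x)) ≤ LebesgueLp.seminorm s x ∧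
          LebesgueLp.seminorm q (superposition p a b f (η, x) - superposition p a b f (η₀, x)) ≤
            δ * LebesgueLp.seminorm s x := by
  obtain ⟨r, hr, s, hs, hb⟩ := H.exists_lipschitz_bound hV (isCompact_range η₀.continuous)
    (range_subset_iff.2 hη₀) q.2
  refine ⟨r, hr, ⟨s, hs⟩, fun η δ hδ0 hδ1 hle => ?_⟩
  have hb' := fun t => hb (η₀ t) (mem_range_self t) (η t) ((hle t).trans_lt hδ1)
  have hη : η ∈ contMapsInto a b V := fun t => (hb' t).1
  refine ⟨hη, fun x => ?_⟩
  obtain ⟨γ, rfl⟩ := LebesgueLp.mk_surjective x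
  rw [H.superposition_mk hV hη, H.superposition_mk hV hη₀, ← map_sub]
  refine ⟨?_, LebesgueLp.seminorm_mk_le q ⟨s, hs⟩ hδ0 fun t => ?_⟩
  · rw [← one_mul (LebesgueLp.seminorm ⟨s, hs⟩ _)]
    refine LebesgueLp.seminorm_mk_le q ⟨s, hs⟩ zero_le_one fun t => ?_
    rw [one_mul]
    exact ((hb' t).2 _).1
  · exact ((hb' t).2 _).2.trans (mul_le_mul_of_nonneg_right (hle t) (apply_nonneg s _))

theorem exists_superposition_slope_bound {g' : ((E₁ × E₁) × (E₁ × E₁)) × E₂ → F}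
    (H : HasContPartialDeriv V f g) (H' : HasContPartialDeriv (V ×ˢ (univ : Set E₁)) g g')
    (hV : IsOpen V) {η₀ : C(Icc a b, E₁)} (hη₀ : η₀ ∈ contMapsInto a b V) (η₁ : C(Icc a b, E₁))
    (q : {q : Seminorm ℝ F // Continuous q}) :
    ∃ r : Seminorm ℝ E₁, Continuous r ∧ ∃ s : {s : Seminorm ℝ E₂ // Continuous s},
      ∀ h δ : ℝ, h ≠ 0 → 0 ≤ δ → δ < 1 → η₀ + h • η₁ ∈ contMapsInto a b V →
        (∀ t, r ((η₀ + h • η₁) t - η₀ t) ≤ δ) → ∀ x : LebesgueLp p a b E₂,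
          LebesgueLp.seminorm q (h⁻¹ • (superposition p a b f (η₀ + h • η₁, x) -
            superposition p a b f (η₀, x)) - superposition p a b g (η₀.prodMk η₁, x)) ≤
            δ * LebesgueLp.seminorm s x := by
  obtain ⟨r, hr, s, hs, hb⟩ := H.exists_slope_bound H' hV
    (isCompact_range (η₀.prodMk η₁).continuous)
    (range_subset_iff.2 fun t => ⟨hη₀ t, mem_univ _⟩) q.2
  refine ⟨r, hr, ⟨s, hs⟩, fun h δ hh hδ0 hδ1 hη hle x => ?_⟩
  have hη' : η₀.prodMk η₁ ∈ contMapsInto a b (V ×ˢ (univ : Set E₁)) :=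
    fun t => ⟨hη₀ t, mem_univ _⟩
  obtain ⟨γ, rfl⟩ := LebesgueLp.mk_surjective x
  rw [H.superposition_mk hV hη, H.superposition_mk hV hη₀,
    H'.superposition_mk (hV.prod isOpen_univ) hη', ← map_sub, ← map_smul, ← map_sub]
  refine LebesgueLp.seminorm_mk_le q ⟨s, hs⟩ hδ0 fun t => ?_
  have hle' : r (h • η₁ t) ≤ δ := by simpa using hle t
  exact (hb (η₀ t) (η₁ t) ⟨t, rfl⟩ h hh (hle'.trans_lt hδ1) (γ.1 t)).trans
    (mul_le_mul_of_nonneg_right hle' (apply_nonneg s _))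

theorem continuousOn_superposition (H : HasContPartialDeriv V f g) (hV : IsOpen V) :
    ContinuousOn (superposition p a b f)
      (contMapsInto a b V ×ˢ (univ : Set (LebesgueLp p a b E₂))) := by
  rintro ⟨η₀, x₀⟩ ⟨hη₀, -⟩
  refine ContinuousAt.continuousWithinAt ((LebesgueLp.withSeminorms.tendsto_nhds _ _).2 ?_)
  intro q ε hε
  change ∀ᶠ z in 𝓝 (η₀, x₀), LebesgueLp.seminorm q _ < ε
  obtain ⟨r, hr, s, hb⟩ := H.exists_superposition_bound (p := p) hV hη₀ q
  obtain ⟨δ, hδ0, hδ1, hδ⟩ := exists_pos_lt_one_mul_lt (c := LebesgueLp.seminorm s x₀) (half_pos hε)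
  have h1 : ∀ᶠ z : C(Icc a b, E₁) × LebesgueLp p a b E₂ in 𝓝 (η₀, x₀),
      ∀ t, r (z.1 t - η₀ t) < δ :=
    (continuous_fst.tendsto (η₀, x₀)).eventually (eventually_forall_seminorm_sub_lt hr η₀ hδ0)
  have h2 : ∀ᶠ z : C(Icc a b, E₁) × LebesgueLp p a b E₂ in 𝓝 (η₀, x₀),
      LebesgueLp.seminorm s (z.2 - x₀) < ε / 2 :=
    (continuous_snd.tendsto (η₀, x₀)).eventually
      ((LebesgueLp.withSeminorms.tendsto_nhds id x₀).1 tendsto_id s _ (half_pos hε))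
  filter_upwards [h1, h2] with ⟨η, x⟩ h1 h2
  obtain ⟨hη, hb⟩ := hb η δ hδ0.le hδ1 fun t => (h1 t).le
  -- The first summand is small by the bound uniform in `η` near `η₀`, the second by the Lipschitz
  -- estimate at the fixed `x₀`.
  have h3 : superposition p a b f (η, x) - superposition p a b f (η₀, x₀) =
      superposition p a b f (η, x - x₀) +
        (superposition p a b f (η, x₀) - superposition p a b f (η₀, x₀)) := by
    rw [(H.isLinearMap_superposition hV hη).map_sub]
    abel
  rw [h3]
  have h4 := map_add_le_add (LebesgueLp.seminorm q) (superposition p a b f (η, x - x₀))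
    (superposition p a b f (η, x₀) - superposition p a b f (η₀, x₀))
  have h5 := (hb (x - x₀)).1
  have h6 := (hb x₀).2
  dsimp only at h2
  linarith

theorem tendsto_superposition_slope {g' : ((E₁ × E₁) × (E₁ × E₁)) × E₂ → F}
    (H : HasContPartialDeriv V f g) (H' : HasContPartialDeriv (V ×ˢ (univ : Set E₁)) g g')
    (hV : IsOpen V) {η₀ : C(Icc a b, E₁)} (hη₀ : η₀ ∈ contMapsInto a b V) (η₁ : C(Icc a b, E₁))
    (x₀ x₁ : LebesgueLp p a b E₂) :
    Tendsto (fun h : ℝ => h⁻¹ • (superposition p a b f ((η₀, x₀) + h • (η₁, x₁)) -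
        superposition p a b f (η₀, x₀))) (𝓝[≠] 0)
      (𝓝 (superposition p a b g (η₀.prodMk η₁, x₀) + superposition p a b f (η₀, x₁))) := by
  have hline : Tendsto (fun h : ℝ => η₀ + h • η₁) (𝓝[≠] 0) (𝓝 η₀) := by
    have := Continuous.tendsto (f := fun h : ℝ => η₀ + h • η₁) (by fun_prop) 0
    rw [zero_smul, add_zero] at this
    exact this.mono_left nhdsWithin_le_nhds
  have hmem : ∀ᶠ h : ℝ in 𝓝[≠] 0, η₀ + h • η₁ ∈ contMapsInto a b V :=
    eventually_add_smul_mem (isOpen_contMapsInto a b hV) hη₀ η₁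
  have h1 : Tendsto (fun h : ℝ => h⁻¹ • (superposition p a b f (η₀ + h • η₁, x₀) -
      superposition p a b f (η₀, x₀))) (𝓝[≠] 0)
      (𝓝 (superposition p a b g (η₀.prodMk η₁, x₀))) := by
    refine (LebesgueLp.withSeminorms.tendsto_nhds _ _).2 fun q ε hε => ?_
    obtain ⟨r, hr, s, hb⟩ := H.exists_superposition_slope_bound (p := p) H' hV hη₀ η₁ q
    obtain ⟨δ, hδ0, hδ1, hδ⟩ := exists_pos_lt_one_mul_lt (c := LebesgueLp.seminorm s x₀) hε
    filter_upwards [hmem, hline.eventually (eventually_forall_seminorm_sub_lt hr η₀ hδ0),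
      eventually_mem_nhdsWithin] with h hh1 hh2 hh3
    exact (hb h δ hh3 hδ0.le hδ1 hh1 (fun t => (hh2 t).le) x₀).trans_lt hδ
  have h2 : Tendsto (fun h : ℝ => superposition p a b f (η₀ + h • η₁, x₁)) (𝓝[≠] 0)
      (𝓝 (superposition p a b f (η₀, x₁))) := by
    have hc := (H.continuousOn_superposition (p := p) (a := a) (b := b) hV).continuousAt
      (((isOpen_contMapsInto a b hV).prod isOpen_univ).mem_nhds
        (mk_mem_prod hη₀ (mem_univ x₁)))
    exact hc.tendsto.comp (hline.prodMk_nhds tendsto_const_nhds)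
  -- By linearity in the second argument, the increment `h • x₁` contributes exactly `Θ_f (η₀ + h •
  -- η₁, x₁)` to the quotient, so continuity suffices for that part.
  refine (h1.add h2).congr' ?_
  filter_upwards [hmem, eventually_mem_nhdsWithin] with h hh (hh0 : h ≠ 0)
  have hl := H.isLinearMap_superposition (p := p) hV hh
  change _ = h⁻¹ • (superposition p a b f (η₀ + h • η₁, x₀ + h • x₁) - _)
  rw [hl.map_add, hl.map_smul, add_sub_right_comm, smul_add, inv_smul_smul₀ hh0]

end HasContPartialDeriv

end Superposition

/-! ### Induction on the order of differentiability. -/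

section Main

universe u₁ u₂

theorem BastianiCn.continuousOn {F : Type v} [AddCommGroup F] [Module ℝ F] [TopologicalSpace F]
    {n : ℕ} {E : Type u} [AddCommGroup E] [Module ℝ E] [TopologicalSpace E]
    {U : Set E} {f : E → F} (h : BastianiCn n U f) : ContinuousOn f U := by
  cases n with
  | zero => exact h
  | succ n => exact h.1

variable {E₂ : Type u₂} [AddCommGroup E₂] [Module ℝ E₂] [TopologicalSpace E₂]
    {F : Type v} [AddCommGroup F] [Module ℝ F] [TopologicalSpace F]

/-- Take `g ((x, y), v) = df ((x, v), (y, 0))`: precomposing `df` with a continuous linear map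
preserves its regularity. -/
theorem BastianiCn.exists_hasContPartialDeriv
    {E₁ : Type u₁} [AddCommGroup E₁] [Module ℝ E₁] [TopologicalSpace E₁]
    {n : ℕ} {V : Set E₁} {f : E₁ × E₂ → F}
    (hf : BastianiCn (n + 1) (V ×ˢ (univ : Set E₂)) f)
    (hlin : ∀ x ∈ V, IsLinearMap ℝ fun v : E₂ => f (x, v)) :
    ∃ g : (E₁ × E₁) × E₂ → F, HasContPartialDeriv V f g ∧
      BastianiCn n ((V ×ˢ (univ : Set E₁)) ×ˢ (univ : Set E₂)) g := by
  obtain ⟨hc, df, hd, hdf⟩ := hf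
  let L : ((E₁ × E₁) × E₂) →L[ℝ] (E₁ × E₂) × (E₁ × E₂) :=
    (((ContinuousLinearMap.fst ℝ E₁ E₁).comp (ContinuousLinearMap.fst ℝ (E₁ × E₁) E₂)).prod
      (ContinuousLinearMap.snd ℝ (E₁ × E₁) E₂)).prod
    (((ContinuousLinearMap.snd ℝ E₁ E₁).comp (ContinuousLinearMap.fst ℝ (E₁ × E₁) E₂)).prod 0)
  have hg : BastianiCn n ((V ×ˢ (univ : Set E₁)) ×ˢ (univ : Set E₂)) fun z => df (L z) :=
    hdf.comp_continuousLinearMap n L fun z hz => ⟨⟨hz.1.1, mem_univ _⟩, mem_univ _⟩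
  refine ⟨fun z => df (L z), ⟨hlin, hc, hg.continuousOn, fun x hx y v => ?_⟩, hg⟩
  have := hd (x, v) ⟨hx, mem_univ _⟩ (y, 0)
  simpa [L] using this

variable [IsTopologicalAddGroup E₂] [ContinuousSMul ℝ E₂] [LocallyConvexSpace ℝ E₂]
    [IsTopologicalAddGroup F] [ContinuousSMul ℝ F] [T2Space F]

/-- The space `E₁` is quantified inside the induction because the hypothesis is applied to `g`,
whose first argument lives in `E₁ × E₁`. -/
theorem bastianiCn_superposition {p : ℝ≥0∞} [Fact (1 ≤ p)] {a b : ℝ} (n : ℕ) :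
    ∀ {E₁ : Type u₁} [AddCommGroup E₁] [Module ℝ E₁] [TopologicalSpace E₁]
      [IsTopologicalAddGroup E₁] [ContinuousSMul ℝ E₁] [LocallyConvexSpace ℝ E₁]
      {V : Set E₁} (_ : IsOpen V) {f : E₁ × E₂ → F}
      (_ : BastianiCn (n + 1) (V ×ˢ (univ : Set E₂)) f)
      (_ : ∀ x ∈ V, IsLinearMap ℝ fun v : E₂ => f (x, v)),
      BastianiCn n (contMapsInto a b V ×ˢ (univ : Set (LebesgueLp p a b E₂)))
        (superposition p a b f) := by
  induction n with
  | zero =>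
    intro E₁ _ _ _ _ _ _ V hV f hf hlin
    obtain ⟨g, H, -⟩ := hf.exists_hasContPartialDeriv hlin
    exact H.continuousOn_superposition hV
  | succ n ih =>
    intro E₁ _ _ _ _ _ _ V hV f hf hlin
    obtain ⟨g, H, hg⟩ := hf.exists_hasContPartialDeriv hlin
    have hlin' : ∀ z ∈ V ×ˢ (univ : Set E₁), IsLinearMap ℝ fun v : E₂ => g (z, v) :=
      fun z hz => H.isLinearMap_deriv hV hz.1 z.2
    obtain ⟨g', H', -⟩ := hg.exists_hasContPartialDeriv hlin'
    refine ⟨H.continuousOn_superposition hV, fun z =>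
      superposition p a b g (z.1.1.prodMk z.2.1, z.1.2) + superposition p a b f (z.1.1, z.2.2),
      ?_, ?_⟩
    · rintro ⟨η₀, x₀⟩ ⟨hη₀, -⟩ ⟨η₁, x₁⟩
      exact H.tendsto_superposition_slope H' hV hη₀ η₁ x₀ x₁
    · refine BastianiCn.add n ?_ ?_
      · exact (ih (hV.prod isOpen_univ) hg hlin').comp_continuousLinearMap n
          (pairingL a b E₁ (LebesgueLp p a b E₂))
          fun z hz => ⟨fun t => ⟨hz.1.1 t, mem_univ _⟩, mem_univ _⟩
      · let C := C(Icc a b, E₁)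
        let L := LebesgueLp p a b E₂
        exact (ih hV hf.of_succ hlin).comp_continuousLinearMap n
          (((ContinuousLinearMap.fst ℝ C L).comp (ContinuousLinearMap.fst ℝ (C × L) (C × L))).prod
            ((ContinuousLinearMap.snd ℝ C L).comp (ContinuousLinearMap.snd ℝ (C × L) (C × L))))
          fun z hz => ⟨hz.1.1, mem_univ _⟩

end Main
end

theorem mainTheorem6
    {E₁ : Type*} [AddCommGroup E₁] [Module ℝ E₁] [TopologicalSpace E₁]
    [IsTopologicalAddGroup E₁] [ContinuousSMul ℝ E₁] [LocallyConvexSpace ℝ E₁] [T2Space E₁]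
    {E₂ : Type*} [AddCommGroup E₂] [Module ℝ E₂] [TopologicalSpace E₂]
    [IsTopologicalAddGroup E₂] [ContinuousSMul ℝ E₂] [LocallyConvexSpace ℝ E₂] [T2Space E₂]
    {F : Type*} [AddCommGroup F] [Module ℝ F] [TopologicalSpace F]
    [IsTopologicalAddGroup F] [ContinuousSMul ℝ F] [LocallyConvexSpace ℝ F] [T2Space F]
    {a b : ℝ} (hab : a < b) (p : ENNReal) [Fact (1 ≤ p)] (k : ℕ∞)
    (V : Set E₁) (hV : IsOpen V) (f : E₁ × E₂ → F)
    (hf : BastianiC (k + 1) (V ×ˢ (Set.univ : Set E₂)) f)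
    (hlin : ∀ x ∈ V, IsLinearMap ℝ (fun v : E₂ => f (x, v))) :
    ∃ Θ : C(Set.Icc a b, E₁) × LebesgueLp p a b E₂ → LebesgueLp p a b F,
      (∀ η ∈ contMapsInto a b V, ∀ γ : CurlyLp p a b E₂,
        ∃ h : (fun t => f (η t, γ.1 t)) ∈ CurlyLp p a b F,
          Θ (η, LebesgueLp.mk γ) = LebesgueLp.mk ⟨fun t => f (η t, γ.1 t), h⟩) ∧
      BastianiC k (contMapsInto a b V ×ˢ (Set.univ : Set (LebesgueLp p a b E₂))) Θ := by
  have hf1 : BastianiCn (0 + 1) (V ×ˢ (Set.univ : Set E₂)) f := hf 1 (by simp)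
  obtain ⟨g, H, -⟩ := hf1.exists_hasContPartialDeriv hlin
  refine ⟨superposition p a b f, fun η hη γ =>
    ⟨H.comp_mem_curlyLp hV hη γ, H.superposition_mk hV hη γ⟩, fun n hn => ?_⟩
  -- The operator does not depend on `n`, so `k = ∞` needs no separate argument.
  refine bastianiCn_superposition n hV (hf (n + 1) ?_) hlin
  push_cast
  gcongr
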